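/- Let $G$ be a second countable, locally compact Hausdorff group with left Haar measure $\mu_G$, and let $\rho_G$ be the right Haar measure $\rho_G(A)=\mu_G(A^{-1})$. Assume that $G$ is amenable, i.e. there is a left invariant mean on $L^\infty(G)$. Let $(\pi,\mathcal H_\pi)$ be a projective unitary representation of $G$ on a complex Hilbert space: a strongly measurable map $\pi:G\to\mathcal U(\mathcal H_\pi)$ with $\pi(e)=I$ and $\pi(g_1)\pi(g_2)=\sigma(g_1,g_2)\pi(g_1g_2)$ for some measurable $\sigma:G\times G\to\mathbb T$. For $\psi,f\in\mathcal H_\pi$ put $C_\psi f(g)=\langle f,\pi(g)\psi\rangle$, and let $\|C_\psi f\|\in[0,\infty]$ be its norm in $L^2(G,\mu_G)$. Fix a compact neighbourhood $Q$ of the identity, put $(MF)(g)=\sup_{q\in Q}|F(gq)|$, let $W(L^2)=\{F\in L^\infty_{\rm loc}(G): \|MF\|_{L^2(G,\mu_G)}<\infty\}$, and let $\mathcal B_\pi$ be the set of all $\psi\in\mathcal H_\pi$ such that $C_\psi f\in W(L^2)$ for every $f\in\mathcal H_\pi$. For $\Lambda\subseteq G$, the family $\pi(\Lambda)\psi=(\pi(\lambda)\psi)_{\lambda\in\Lambda}$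 is Bessel with bound $C_2$ if $\sum_{\lambda\in\Lambda}|\langle f,\pi(\lambda)\psi\rangle|^2\le C_2\|f\|^2$ for all $f\in\mathcal H_\pi$, and it has lower frame bound $C_1$ if $\sum_{\lambda\in\Lambda}|\langle f,\pi(\lambda)\psi\rangle|^2\ge C_1\|f\|^2$ for all $f\in\mathcal H_\pi$. For $S\subseteq G$, the set $\Lambda$ is $S$-separated (respectively $S$-dense) if $\#(\Lambda\cap gS)\le1$ (respectively $\ge1$) for all $g\in G$. Let $\psi\in\mathcal H_\pi$. (1) Let $U\subseteq G$ be nonempty and open, let $K\subseteq G$ be compact, and let $\Lambda\subseteq G$ be $U$-separated and $K$-dense. If $\pi(\Lambda)\psi$ is Bessel with bound $C_2>0$, then $$\|C_\psi f\|^2\le C_2\,\mu_G(K)\,\|f\|^2\qquad\text{for all } f\in\mathcal H_\pi .$$ If, in addition, $\psi\in\mathcal B_\pi$ and $\pi(\Lambda)\psi$ also has a lower frame bound $C_1>0$, then $$\|C_\psi f\|^2\ge C_1\,\mu_G(U)\,\|f\|^2\qquad\text{for all } f\in\mathcal H_\pi .$$ (2) Let $\Lambda\subseteq G$ be a quasi-lattice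 with complement $C$, that is, $G$ is the disjoint union of the sets $\lambda C$, $\lambda\in\Lambda$, where $C$ is relatively compact and Jordan measurable, that is, $\mu_G(\partial C)=0$. If $\psi\in\mathcal B_\pi$ and $\pi(\Lambda)\psi$ is a frame with bounds $C_1,C_2>0$ (lower frame bound $C_1$ and Bessel bound $C_2$), then $$C_1\|f\|^2\le\frac{\|C_\psi f\|^2}{\rho_G(C)}\le C_2\|f\|^2\qquad\text{for all } f\in\mathcal H_\pi$$ (in the degenerate case $\mathcal H_\pi=\{0\}$, where $\rho_G(C)=0$ is possible, the quotient is read as $0$). -/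

import Mathlib

open MeasureTheory Topology
open scoped ENNReal Pointwise

/-! ### Amenability -/

section Amenable

variable (G : Type*) [Group G] [TopologicalSpace G] [IsTopologicalGroup G]
  [LocallyCompactSpace G] [MeasurableSpace G] [BorelSpace G]

/-- The left translate `x ↦ F (g⁻¹ * x)` of a class `F ∈ L^∞(G)` (with respect to left Haar
measure). -/
noncomputable def leftTranslateLinfty (g : G) (F : Lp ℝ ∞ (Measure.haar : Measure G)) :
    Lp ℝ ∞ (Measure.haar : Measure G) :=
  Lp.compMeasurePreserving (fun x => g⁻¹ * x)
    (measurePreserving_mul_left (Measure.haar : Measure G) g⁻¹) F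

/-- A locally compact group `G` is amenable if there is a left invariant mean on `L^∞(G)`, i.e. a
positive normalized linear functional that is invariant under left translations. The space
`L^∞(G)` does not depend on the choice of the left Haar measure. -/
def IsAmenableGroup : Prop :=
  ∃ m : Lp ℝ ∞ (Measure.haar : Measure G) →ₗ[ℝ] ℝ,
    (∀ F, 0 ≤ F → 0 ≤ m F) ∧
    m ((memLp_top_const (1 : ℝ)).toLp (fun _ : G => (1 : ℝ))) = 1 ∧
    ∀ (g : G) (F), m (leftTranslateLinfty G g F) = m F

end Amenable

/-! ### Point sets -/

section PointSets

variable {G : Type*} [Group G]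

/-- `Λ` is `S`-separated: every left translate `g S` contains at most one point of `Λ`. -/
def IsSeparatedBy (Λ S : Set G) : Prop :=
  ∀ g : G, (Λ ∩ g • S).encard ≤ 1

/-- `Λ` is `S`-dense: every left translate `g S` contains at least one point of `Λ`. -/
def IsDenseBy (Λ S : Set G) : Prop :=
  ∀ g : G, 1 ≤ (Λ ∩ g • S).encard

/-- `Λ` is a quasi-lattice with complement `C`: `G` is the disjoint union of the sets `l C`,
`l ∈ Λ`. -/
def IsQuasiLattice (Λ C : Set G) : Prop :=
  (⋃ l ∈ Λ, l • C) = Set.univ ∧ Λ.PairwiseDisjoint (fun l => l • C)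

/-- `C` is Jordan measurable with respect to `μ`: its topological boundary is a null set. -/
def IsJordanMeasurable [TopologicalSpace G] [MeasurableSpace G] (μ : Measure G) (C : Set G) :
    Prop :=
  μ (frontier C) = 0

end PointSets

/-! ### Bessel sequences and frames -/

section Frames

variable {ι H : Type*} [NormedAddCommGroup H] [InnerProductSpace ℂ H]

/-- The family `φ` is a Bessel sequence with bound `B`: `∑ i, |⟨f, φ i⟩|² ≤ B ‖f‖²` for all `f`.
The sum is taken in `[0, ∞]`. -/
def IsBesselWith (φ : ι → H) (B : ℝ) : Prop :=
  ∀ f : H, ∑' i, ‖inner ℂ (φ i) f‖ₑ ^ 2 ≤ ENNReal.ofReal B * ‖f‖ₑ ^ 2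

/-- The family `φ` admits the lower frame bound `A`: `A ‖f‖² ≤ ∑ i, |⟨f, φ i⟩|²` for all `f`. -/
def HasLowerFrameBound (φ : ι → H) (A : ℝ) : Prop :=
  ∀ f : H, ENNReal.ofReal A * ‖f‖ₑ ^ 2 ≤ ∑' i, ‖inner ℂ (φ i) f‖ₑ ^ 2

end Frames

/-! ### Projective unitary representations and the wavelet transform -/

section Representations

variable {G H : Type*} [Group G] [MeasurableSpace G] [NormedAddCommGroup H]
  [InnerProductSpace ℂ H]

/-- `π : G → U(H)` is a projective unitary representation: strongly measurable, unital, and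
multiplicative up to a measurable `𝕋`-valued function `σ`. -/
structure IsProjectiveUnitaryRep (π : G → (H ≃ₗᵢ[ℂ] H)) : Prop where
  stronglyMeasurable : ∀ f : H, StronglyMeasurable (fun g => π g f)
  map_one : ∀ f : H, π 1 f = f
  map_mul : ∃ σ : G × G → Circle, Measurable (fun p => (σ p : ℂ)) ∧
    ∀ (g₁ g₂ : G) (f : H), π g₁ (π g₂ f) = (σ (g₁, g₂) : ℂ) • π (g₁ * g₂) f

/-- The wavelet transform `C_ψ f (g) = ⟨f, π(g) ψ⟩`. The inner product of the mathematical text is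
linear in the first argument, Mathlib's in the second one. -/
noncomputable def waveletTransform (π : G → (H ≃ₗᵢ[ℂ] H)) (ψ f : H) (g : G) : ℂ :=
  inner ℂ (π g ψ) f

/-- The orbit `π(Λ) ψ`, as a family indexed by `Λ`. -/
def orbitFamily (π : G → (H ≃ₗᵢ[ℂ] H)) (Λ : Set G) (ψ : H) : Λ → H :=
  fun l => π (l : G) ψ

/-- The local maximal function `M F (g) = sup_{q ∈ Q} |F (g q)|`, with values in `[0, ∞]`. -/
noncomputable def localMaximal (Q : Set G) (F : G → ℂ) (g : G) : ℝ≥0∞ :=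
  ⨆ q ∈ Q, ‖F (g * q)‖ₑ

/-- `F ∈ L^∞_loc(G)`: measurable and essentially bounded on every compact set. -/
def MemLocLinfty [TopologicalSpace G] (μ : Measure G) (F : G → ℂ) : Prop :=
  AEStronglyMeasurable F μ ∧ ∀ K : Set G, IsCompact K → eLpNorm F ∞ (μ.restrict K) < ∞

/-- `F ∈ W(L²)`: `F` is in `L^∞_loc(G)` and its local maximal function has finite `L²` norm. -/
def MemWienerL2 [TopologicalSpace G] (μ : Measure G) (Q : Set G) (F : G → ℂ) : Prop :=
  MemLocLinfty μ F ∧ eLpNorm (localMaximal Q F) 2 μ < ∞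

/-- The space `𝓑_π` of all `ψ` such that `C_ψ f ∈ W(L²)` for all `f`. -/
def analyzingSpace [TopologicalSpace G] (μ : Measure G) (Q : Set G) (π : G → (H ≃ₗᵢ[ℂ] H)) :
    Set H :=
  {ψ | ∀ f : H, MemWienerL2 μ Q (waveletTransform π ψ f)}

end Representations

/-! ### Sums over uniformly locally finite sets -/

section LocallyFiniteSums

open Filter CompactlySupported
open scoped NNReal

variable {G : Type*} [Group G]

/-! Averaging over `G` turns sums over `Λ` into Haar integrals. For uniformly locally finite `Λ`,
the function `x ↦ ∑ l ∈ Λ, w (x * l)` is bounded and continuous whenever `w ∈ C_c(G)`. Applying the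
invariant mean to it gives a positive, left invariant functional of `w`, hence `c * ∫ w ∂μ` with `c`
depending only on the mean, `Λ` and `μ` (`exists_mean_pointSumLinfty_eq`). Any bound on the sums
that is uniform in `x` therefore bounds `c * ∫ w`. Smoothing by convolution extends this from
`C_c(G)` to bounded measurable functions of compact support.

The constant is tested on two kinds of functions. Indicators of `U` and `K` give `c * μ U ≤ 1 ≤ c *
μ K`. For `|C_ψ f|²`, covariance identifies the sum at `x` with the frame sum of `π(x)⁻¹ f`, a
vector of norm `‖f‖`, so the frame bounds hold uniformly in `x` and `C₁ ‖f‖² ≤ c ‖C_ψ f‖² ≤ C₂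
‖f‖²`. Eliminating `c` gives part (1).

Since `|C_ψ f|²` need not have compact support, it is truncated. This is harmless for the upper
bound; for the lower bound the lost tail must be small uniformly in `x`, which follows from the
square integrable local maximal function provided by `ψ ∈ 𝓑_π`. Part (2) is part (1) for the
inverses of the interior and the closure of `C`, which have equal measure. -/

/-- Every compact set contains, uniformly over its left translates, boundedly many points of `Λ`. -/
def IsUniformlyLocallyFinite [TopologicalSpace G] (Λ : Set G) : Prop :=
  ∀ S : Set G, IsCompact S → ∃ N : ℕ, ∀ x : G, (Λ ∩ x • S).encard ≤ N

/-- Finitely many left translates of `U` cover a compact set, and each of them still meets `Λ` at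
most once after a further left translation. -/
theorem IsSeparatedBy.isUniformlyLocallyFinite [TopologicalSpace G] [IsTopologicalGroup G]
    {Λ U : Set G} (h : IsSeparatedBy Λ U) (hU : IsOpen U) (hne : U.Nonempty) :
    IsUniformlyLocallyFinite Λ := by
  intro S hS
  refine hS.induction_on (p := fun S => ∃ N : ℕ, ∀ x : G, (Λ ∩ x • S).encard ≤ N)
    ⟨0, by simp⟩ ?_ ?_ ?_
  · rintro s t hst ⟨N, hN⟩
    exact ⟨N, fun x => (Set.encard_le_encard (by gcongr)).trans (hN x)⟩
  · rintro s t ⟨N, hN⟩ ⟨M, hM⟩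
    refine ⟨N + M, fun x => ?_⟩
    rw [Set.smul_set_union, Set.inter_union_distrib_left]
    push_cast
    exact (Set.encard_union_le _ _).trans (add_le_add (hN x) (hM x))
  · intro s _
    obtain ⟨u, hu⟩ := hne
    refine ⟨(s * u⁻¹) • U, mem_nhdsWithin_of_mem_nhds ((hU.smul _).mem_nhds
      ⟨u, hu, by simp⟩), 1, fun x => ?_⟩
    rw [smul_smul]
    exact_mod_cast h _

theorem IsUniformlyLocallyFinite.exists_encard_ne_zero_le [TopologicalSpace G] {Λ S : Set G}
    (h : IsUniformlyLocallyFinite Λ) (hS : IsCompact S) :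
    ∃ N : ℕ, ∀ {w : G → ℝ}, (∀ x ∉ S, w x = 0) → ∀ x,
      {l : Λ | w (x * l) ≠ 0}.encard ≤ N := by
  obtain ⟨N, hN⟩ := h S hS
  refine ⟨N, fun {w} hw x => ?_⟩
  rw [← Subtype.val_injective.encard_image]
  refine (Set.encard_le_encard ?_).trans (hN x⁻¹)
  rintro _ ⟨l, hl, rfl⟩
  refine ⟨l.2, x * l, ?_, by simp⟩
  by_contra hS
  exact hl (hw _ hS)

theorem IsUniformlyLocallyFinite.finite_ne_zero [TopologicalSpace G] {Λ S : Set G}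
    (h : IsUniformlyLocallyFinite Λ) (hS : IsCompact S) {w : G → ℝ} (hw : ∀ x ∉ S, w x = 0)
    (x : G) : {l : Λ | w (x * l) ≠ 0}.Finite := by
  obtain ⟨N, hN⟩ := h.exists_encard_ne_zero_le hS
  exact Set.finite_of_encard_le_coe (hN hw x)

/-- The sum `∑ l ∈ Λ, w (x * l)`. -/
noncomputable def pointSum (Λ : Set G) (w : G → ℝ) (x : G) : ℝ :=
  ∑ᶠ l : Λ, w (x * l)

theorem IsUniformlyLocallyFinite.exists_abs_pointSum_le [TopologicalSpace G] {Λ S : Set G}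
    (h : IsUniformlyLocallyFinite Λ) (hS : IsCompact S) {w : G → ℝ} (hw : ∀ x ∉ S, w x = 0)
    {M : ℝ} (hM : ∀ x, |w x| ≤ M) : ∃ B : ℝ, ∀ x, |pointSum Λ w x| ≤ B := by
  obtain ⟨N, hN⟩ := h.exists_encard_ne_zero_le hS
  refine ⟨N * M, fun x => ?_⟩
  have hM0 : 0 ≤ M := (abs_nonneg _).trans (hM 1)
  have hf : (Function.support fun l : Λ => w (x * l)).Finite := h.finite_ne_zero hS hw x
  rw [pointSum, finsum_eq_sum _ hf]
  refine (Finset.abs_sum_le_sum_abs _ _).trans ((Finset.sum_le_card_nsmul _ _ M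
    fun l _ => hM _).trans ?_)
  rw [nsmul_eq_mul]
  gcongr
  have := hN hw x
  rw [show {l : Λ | w (x * l) ≠ 0} = Function.support fun l : Λ => w (x * l) from rfl,
    hf.encard_eq_coe_toFinset_card] at this
  exact_mod_cast this

theorem IsUniformlyLocallyFinite.continuous_pointSum [TopologicalSpace G] [IsTopologicalGroup G]
    [LocallyCompactSpace G] {Λ S : Set G} (h : IsUniformlyLocallyFinite Λ) (hS : IsCompact S)
    {w : G → ℝ} (hw : ∀ x ∉ S, w x = 0) (hc : Continuous w) : Continuous (pointSum Λ w) := by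
  refine continuous_finsum (fun l => by fun_prop) fun x => ?_
  obtain ⟨N, hN, hx⟩ := exists_compact_mem_nhds x
  obtain ⟨n, hn⟩ := h (N⁻¹ * S) (hN.inv.mul hS)
  have hfin : (Λ ∩ (1 : G) • (N⁻¹ * S)).Finite := Set.finite_of_encard_le_coe (hn 1)
  refine ⟨N, hx, (hfin.preimage Subtype.val_injective.injOn).subset ?_⟩
  rintro l ⟨y, hy, hyN⟩
  refine ⟨l.2, ?_⟩
  rw [one_smul]
  refine ⟨y⁻¹, Set.inv_mem_inv.2 hyN, y * l, ?_, by simp⟩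
  by_contra hS
  exact hy (hw _ hS)

theorem IsUniformlyLocallyFinite.pointSum_add [TopologicalSpace G] {Λ S T : Set G}
    (h : IsUniformlyLocallyFinite Λ) (hS : IsCompact S) (hT : IsCompact T) {v w : G → ℝ}
    (hv : ∀ x ∉ S, v x = 0) (hw : ∀ x ∉ T, w x = 0) (x : G) :
    pointSum Λ (v + w) x = pointSum Λ v x + pointSum Λ w x :=
  finsum_add_distrib (h.finite_ne_zero hS hv x) (h.finite_ne_zero hT hw x)

theorem pointSum_smul (Λ : Set G) (a : ℝ) (w : G → ℝ) (x : G) :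
    pointSum Λ (a • w) x = a * pointSum Λ w x := by
  simp only [pointSum, Pi.smul_apply]
  rw [← smul_eq_mul, smul_finsum]

theorem pointSum_nonneg (Λ : Set G) {w : G → ℝ} (hw : 0 ≤ w) (x : G) : 0 ≤ pointSum Λ w x :=
  finsum_nonneg fun _ => hw _

theorem pointSum_comp_mul_left (Λ : Set G) (w : G → ℝ) (g x : G) :
    pointSum Λ (fun y => w (g * y)) x = pointSum Λ w (g * x) := by
  simp only [pointSum, mul_assoc]

end LocallyFiniteSums

/-! ### The invariant mean of point sums as a Haar integral -/

section InvariantMean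

open Filter CompactlySupported
open scoped NNReal

variable {G : Type*} [Group G] [TopologicalSpace G] [IsTopologicalGroup G]
  [LocallyCompactSpace G] [MeasurableSpace G] [BorelSpace G]

theorem IsUniformlyLocallyFinite.memLp_pointSum {Λ : Set G} (h : IsUniformlyLocallyFinite Λ)
    (w : C_c(G, ℝ)) : MemLp (pointSum Λ w) ∞ (Measure.haar : Measure G) := by
  have hw : ∀ x ∉ tsupport w, w x = 0 := fun x => image_eq_zero_of_notMem_tsupport
  obtain ⟨M, hM⟩ := w.hasCompactSupport.exists_bound_of_continuous w.continuous
  obtain ⟨B, hB⟩ := h.exists_abs_pointSum_le w.hasCompactSupport hw hM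
  exact memLp_top_of_bound (h.continuous_pointSum w.hasCompactSupport hw
    w.continuous).aestronglyMeasurable B (Eventually.of_forall hB)

/-- The map `w ↦ ∑ l ∈ Λ, w (· * l)` from `C_c(G)` to `L^∞(G)`. -/
noncomputable def pointSumLinfty {Λ : Set G} (h : IsUniformlyLocallyFinite Λ) :
    C_c(G, ℝ) →ₗ[ℝ] Lp ℝ ∞ (Measure.haar : Measure G) where
  toFun w := (h.memLp_pointSum w).toLp _
  map_add' v w := by
    rw [← MemLp.toLp_add]
    refine MemLp.toLp_congr _ _ (Eventually.of_forall fun x => ?_)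
    exact h.pointSum_add v.hasCompactSupport w.hasCompactSupport
      (fun x => image_eq_zero_of_notMem_tsupport) (fun x => image_eq_zero_of_notMem_tsupport) x
  map_smul' a w := by
    rw [RingHom.id_apply, ← MemLp.toLp_const_smul]
    exact MemLp.toLp_congr _ _ (Eventually.of_forall fun x => pointSum_smul Λ a w x)

/-- An invariant mean of the sums over `Λ` is a multiple of Haar measure. -/
theorem exists_mean_pointSumLinfty_eq [T2Space G] (μ : Measure G) [μ.IsHaarMeasure]
    {m : Lp ℝ ∞ (Measure.haar : Measure G) →ₗ[ℝ] ℝ} (hpos : ∀ F, 0 ≤ F → 0 ≤ m F)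
    (hinv : ∀ (g : G) (F), m (leftTranslateLinfty G g F) = m F)
    {Λ : Set G} (h : IsUniformlyLocallyFinite Λ) :
    ∃ c : ℝ≥0, ∀ w : C_c(G, ℝ), m (pointSumLinfty h w) = c * ∫ x, w x ∂μ := by
  let I : C_c(G, ℝ) →ₚ[ℝ] ℝ := PositiveLinearMap.mk₀ (m ∘ₗ pointSumLinfty h) fun w hw => by
    refine hpos _ ?_
    rw [← Lp.coeFn_nonneg]
    filter_upwards [(h.memLp_pointSum w).coeFn_toLp] with x hx
    exact (pointSum_nonneg Λ hw x).trans_eq hx.symm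
  have hI : ∀ w, I w = m (pointSumLinfty h w) := fun _ => rfl
  set ν := RealRMK.rieszMeasure I
  have hν : ν.IsMulLeftInvariant := by
    refine ⟨fun g => ?_⟩
    have : (ν.map (g * ·)).Regular := Measure.Regular.map (Homeomorph.mulLeft g)
    refine Measure.ext_of_integral_eq_on_compactlySupported fun f => ?_
    rw [integral_map (by fun_prop) (by fun_prop)]
    have hf : ∀ x, f (g * x) = f.comp (Homeomorph.mulLeft g).toCocompactMap x := fun _ => rfl
    simp_rw [hf]
    rw [RealRMK.integral_rieszMeasure, RealRMK.integral_rieszMeasure, hI, hI]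
    -- Forming the point sum commutes with left translation: the sum of `f (g * ·)` is the left
    -- translate by `g⁻¹` of the sum of `f`.
    refine (congrArg m ?_).trans (hinv g⁻¹ _)
    refine MemLp.toLp_congr (h.memLp_pointSum _) ((h.memLp_pointSum f).comp_measurePreserving
      (measurePreserving_mul_left _ g⁻¹⁻¹)) (Eventually.of_forall fun x => ?_)
    rw [Function.comp_apply, inv_inv]
    exact pointSum_comp_mul_left Λ f g x
  refine ⟨Measure.haarScalarFactor ν μ, fun w => ?_⟩
  rw [← hI, ← RealRMK.integral_rieszMeasure]
  refine (Measure.integral_isMulLeftInvariant_eq_smul_of_hasCompactSupport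
    ν μ w.continuous w.hasCompactSupport).trans ?_
  rw [integral_smul_nnreal_measure]
  rfl

theorem mean_pointSumLinfty_le {m : Lp ℝ ∞ (Measure.haar : Measure G) →ₗ[ℝ] ℝ}
    (hpos : ∀ F, 0 ≤ F → 0 ≤ m F)
    (hone : m ((memLp_top_const (1 : ℝ)).toLp (fun _ : G => (1 : ℝ))) = 1)
    {Λ : Set G} (h : IsUniformlyLocallyFinite Λ) {w : C_c(G, ℝ)} {B : ℝ}
    (hB : ∀ x, pointSum Λ w x ≤ B) : m (pointSumLinfty h w) ≤ B := by
  have hle : 0 ≤ m (B • (memLp_top_const (1 : ℝ)).toLp (fun _ : G => (1 : ℝ)) -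
      pointSumLinfty h w) := by
    refine hpos _ ?_
    rw [← Lp.coeFn_nonneg]
    have heq : B • (memLp_top_const (1 : ℝ)).toLp (fun _ : G => (1 : ℝ)) - pointSumLinfty h w =
        (((memLp_top_const (1 : ℝ)).const_smul B).sub (h.memLp_pointSum w)).toLp _ := by
      rw [MemLp.toLp_sub ((memLp_top_const (1 : ℝ)).const_smul B) (h.memLp_pointSum w),
        MemLp.toLp_const_smul]
      rfl
    rw [heq]
    filter_upwards [(((memLp_top_const (1 : ℝ)).const_smul B).sub
      (h.memLp_pointSum w)).coeFn_toLp] with x hx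
    rw [hx]
    simpa using hB x
  rw [map_sub, map_smul, hone] at hle
  simpa using hle

end InvariantMean

/-! ### From continuous to bounded measurable functions, by convolution -/

section CoveringConstant

open Filter CompactlySupported
open scoped NNReal

variable {G : Type*} [Group G] [TopologicalSpace G] [IsTopologicalGroup G] [T2Space G]
  [LocallyCompactSpace G] [SecondCountableTopology G] [MeasurableSpace G] [BorelSpace G]

omit [T2Space G] [LocallyCompactSpace G] in
theorem integral_integral_mul_inv_mul (μ : Measure G) [μ.IsHaarMeasure] [SFinite μ] {k u : G → ℝ}
    (hk : Integrable k μ) (hu : Integrable u μ) :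
    ∫ x, ∫ y, k y * u (y⁻¹ * x) ∂μ ∂μ = (∫ y, k y ∂μ) * ∫ x, u x ∂μ := by
  have hint : Integrable (fun p : G × G => k p.1 * u (p.1⁻¹ * p.2)) (μ.prod μ) :=
    (measurePreserving_prod_inv_mul μ μ).integrable_comp_of_integrable (hk.mul_prod hu)
  rw [integral_integral_swap (f := fun x y => k y * u (y⁻¹ * x)) hint.swap, ← integral_mul_const]
  congr with y
  rw [integral_const_mul, integral_mul_left_eq_self u]

theorem continuous_integral_mul_inv_mul (μ : Measure G) [μ.IsHaarMeasure] {k u : G → ℝ}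
    (hk : Continuous k) (hks : HasCompactSupport k) (hu : Measurable u) {M : ℝ}
    (hM : ∀ x, |u x| ≤ M) {E : Set G} (hE : IsCompact E) (huE : ∀ x ∉ E, u x = 0) :
    Continuous fun x => ∫ y, k y * u (y⁻¹ * x) ∂μ := by
  obtain ⟨C, hC⟩ := hks.exists_bound_of_continuous hk
  -- The substitution `y = x * z` moves the dependence on `x` from `u`, which is only measurable, to
  -- the continuous factor `k`.
  have heq : ∀ x, ∫ y, k y * u (y⁻¹ * x) ∂μ = ∫ z, k (x * z) * u z⁻¹ ∂μ := fun x => by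
    rw [← integral_mul_left_eq_self _ x]
    simp
  simp_rw [heq]
  refine continuous_of_dominated (bound := E⁻¹.indicator fun _ => C * M)
    (fun x => Measurable.aestronglyMeasurable (by fun_prop)) (fun x => Eventually.of_forall fun z => ?_) ?_
    (Eventually.of_forall fun z => by fun_prop)
  · by_cases hz : z ∈ E⁻¹
    · rw [Set.indicator_of_mem hz, norm_mul]
      exact mul_le_mul (hC _) (hM _) (norm_nonneg _) ((norm_nonneg _).trans (hC 1))
    · rw [huE _ hz]
      simp [hz]
  · rw [integrable_indicator_iff hE.inv.measurableSet]
    exact integrableOn_const hE.inv.measure_lt_top.ne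

-- The point sum of a convolution is the `k`-weighted integral of the point sums of `u` at `y⁻¹ *
-- x`. As `k ≥ 0`, a uniform upper bound survives the averaging.
omit [T2Space G] [LocallyCompactSpace G] [SecondCountableTopology G] in
theorem IsUniformlyLocallyFinite.pointSum_integral_mul_inv_mul_le (μ : Measure G)
    [μ.IsHaarMeasure] {Λ : Set G} (h : IsUniformlyLocallyFinite Λ) {k u : G → ℝ}
    (hk : Continuous k) (hks : HasCompactSupport k) (hk0 : 0 ≤ k) (hu : Measurable u) {M : ℝ}
    (hM : ∀ x, |u x| ≤ M) {E : Set G} (hE : IsCompact E) (huE : ∀ x ∉ E, u x = 0)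
    {B : ℝ} (hB : ∀ x, pointSum Λ u x ≤ B) (x : G) :
    pointSum Λ (fun x => ∫ y, k y * u (y⁻¹ * x) ∂μ) x ≤ (∫ y, k y ∂μ) * B := by
  obtain ⟨n, hn⟩ := h (tsupport k * E) (hks.mul hE)
  have hfin : {l : Λ | (l : G) ∈ x⁻¹ • (tsupport k * E)}.Finite :=
    ((Set.finite_of_encard_le_coe (hn x⁻¹)).preimage
      Subtype.val_injective.injOn).subset fun l hl => ⟨l.2, hl⟩
  have hmem : ∀ y ∈ tsupport k, ∀ l : Λ, u (y⁻¹ * (x * l)) ≠ 0 → l ∈ hfin.toFinset := by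
    intro y hy l hl
    rw [hfin.mem_toFinset]
    refine ⟨x * l, ⟨y, hy, y⁻¹ * (x * l), ?_, by simp⟩, by simp⟩
    by_contra hE
    exact hl (huE _ hE)
  have hki : Integrable k μ := hk.integrable_of_hasCompactSupport hks
  have hint : ∀ l : Λ, Integrable (fun y => k y * u (y⁻¹ * (x * l))) μ := fun l =>
    hki.mul_bdd (c := M) (Measurable.aestronglyMeasurable (by fun_prop)) (Eventually.of_forall fun y => hM _)
  have hsum : pointSum Λ (fun x => ∫ y, k y * u (y⁻¹ * x) ∂μ) x =
      ∑ l ∈ hfin.toFinset, ∫ y, k y * u (y⁻¹ * (x * l)) ∂μ := by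
    refine finsum_eq_sum_of_support_subset _ fun l hl => ?_
    obtain ⟨y, hy⟩ : ∃ y, k y * u (y⁻¹ * (x * l)) ≠ 0 := by
      by_contra! h0
      exact hl (by simp [h0])
    exact hmem y (subset_tsupport _ (left_ne_zero_of_mul hy)) l (right_ne_zero_of_mul hy)
  rw [hsum, ← integral_finsetSum _ fun l _ => hint l, ← integral_mul_const]
  refine integral_mono (integrable_finsetSum _ fun l _ => hint l) (hki.mul_const B) fun y => ?_
  simp only [← Finset.mul_sum]
  by_cases hy : y ∈ tsupport k
  · refine mul_le_mul_of_nonneg_left ((Eq.le ?_).trans (hB (y⁻¹ * x))) (hk0 y)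
    simp only [pointSum, mul_assoc]
    exact (finsum_eq_sum_of_support_subset _ fun l hl => hmem y hy l hl).symm
  · simp [image_eq_zero_of_notMem_tsupport hy]

/-- In an amenable group, upper bounds of the sums `∑ l ∈ Λ, u (x * l)` over all `x` give bounds
of the Haar integral of `u`, scaled by a constant that depends only on `Λ`. -/
theorem IsUniformlyLocallyFinite.exists_mul_integral_le (hG : IsAmenableGroup G)
    (μ : Measure G) [μ.IsHaarMeasure] {Λ : Set G} (h : IsUniformlyLocallyFinite Λ) :
    ∃ c : ℝ≥0, ∀ {u : G → ℝ} {M B : ℝ} {E : Set G}, Measurable u → (∀ x, |u x| ≤ M) →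
      IsCompact E → (∀ x ∉ E, u x = 0) → (∀ x, pointSum Λ u x ≤ B) →
      c * ∫ x, u x ∂μ ≤ B := by
  obtain ⟨m, hpos, hone, hinv⟩ := hG
  obtain ⟨c, hc⟩ := exists_mean_pointSumLinfty_eq μ hpos hinv h
  refine ⟨c, fun {u M B E} hu hM hE huE hB => ?_⟩
  -- Any nonzero kernel works, without approximating the identity: the factor `∫ k > 0` appears on
  -- both sides and cancels at the end.
  obtain ⟨k, hks, hk0, hk1⟩ := exists_continuous_nonneg_pos (1 : G)
  have hpk : 0 < ∫ x, k x ∂μ :=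
    k.continuous.integral_pos_of_hasCompactSupport_nonneg_nonzero hks hk0 hk1
  let w : C_c(G, ℝ) := ⟨⟨_, continuous_integral_mul_inv_mul μ k.continuous hks hu hM hE huE⟩, by
    refine HasCompactSupport.intro (hks.mul hE) fun x hx => ?_
    refine integral_eq_zero_of_ae (Eventually.of_forall fun y => ?_)
    by_contra h0
    refine hx ⟨y, subset_tsupport _ (left_ne_zero_of_mul h0), y⁻¹ * x, ?_, by simp⟩
    by_contra hE
    exact right_ne_zero_of_mul h0 (huE _ hE)⟩
  have hle := mean_pointSumLinfty_le hpos hone h (w := w)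
    (h.pointSum_integral_mul_inv_mul_le μ k.continuous hks hk0 hu hM hE huE hB)
  have hui : Integrable u μ := by
    rw [← integrableOn_iff_integrable_of_support_subset (s := E)
      fun x hx => by_contra fun hE => hx (huE x hE)]
    exact Measure.integrableOn_of_bounded hE.measure_lt_top.ne hu.aestronglyMeasurable
      (Eventually.of_forall hM)
  have hwi : ∫ x, w x ∂μ = (∫ x, k x ∂μ) * ∫ x, u x ∂μ :=
    integral_integral_mul_inv_mul μ (k.continuous.integrable_of_hasCompactSupport hks) hui
  rw [hc, hwi, mul_left_comm] at hle
  exact le_of_mul_le_mul_left hle hpk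

end CoveringConstant

/-! ### Upper and lower comparison for nonnegative functions -/

section CoveringConstantENNReal

open Filter
open scoped NNReal

variable {G : Type*} [Group G] [TopologicalSpace G]

theorem IsUniformlyLocallyFinite.ofReal_pointSum {Λ S : Set G} (h : IsUniformlyLocallyFinite Λ)
    (hS : IsCompact S) {v : G → ℝ≥0} (hv : ∀ x ∉ S, v x = 0) (x : G) :
    ENNReal.ofReal (pointSum Λ (fun y => (v y : ℝ)) x) = ∑' l : Λ, (v (x * l) : ℝ≥0∞) := by
  have hf := h.finite_ne_zero hS (w := fun y => (v y : ℝ)) (fun y hy => by simp [hv y hy]) x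
  have hs : ∀ l : Λ, l ∉ hf.toFinset → (v (x * l) : ℝ) = 0 := fun l hl => by
    simpa using hl
  rw [pointSum, finsum_eq_sum_of_support_subset _ (s := hf.toFinset) (by simp [Function.support]),
    tsum_eq_sum (s := hf.toFinset) fun l hl => by simpa using hs l hl,
    ENNReal.ofReal_sum_of_nonneg fun _ _ => NNReal.coe_nonneg _]
  simp

variable [IsTopologicalGroup G] [T2Space G]
  [LocallyCompactSpace G] [SecondCountableTopology G] [MeasurableSpace G] [BorelSpace G]

/-- In an amenable group, uniform bounds of the sums `∑ l ∈ Λ, v (x * l)` over all `x` give bounds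
of the Haar integral of `v`, scaled by a constant that depends only on `Λ`. -/
theorem IsUniformlyLocallyFinite.exists_mul_lintegral_le (hG : IsAmenableGroup G)
    (μ : Measure G) [μ.IsHaarMeasure] {Λ : Set G} (h : IsUniformlyLocallyFinite Λ) :
    ∃ c : ℝ≥0, ∀ {v : G → ℝ≥0} {M B : ℝ≥0}, Measurable v → (∀ x, v x ≤ M) →
      ((∀ x, ∑' l : Λ, (v (x * l) : ℝ≥0∞) ≤ B) → c * ∫⁻ x, v x ∂μ ≤ B) ∧
      ∀ E : Set G, IsCompact E → (∀ x ∉ E, v x = 0) →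
        (∀ x, (B : ℝ≥0∞) ≤ ∑' l : Λ, (v (x * l) : ℝ≥0∞)) → B ≤ c * ∫⁻ x, v x ∂μ := by
  obtain ⟨c, hc⟩ := h.exists_mul_integral_le hG μ
  have hlint : ∀ {v : G → ℝ≥0} {M : ℝ≥0} {E : Set G}, Measurable v → (∀ x, v x ≤ M) →
      IsCompact E → (∀ x ∉ E, v x = 0) →
      ∫⁻ x, v x ∂μ = ENNReal.ofReal (∫ x, (v x : ℝ) ∂μ) := by
    intro v M E hv hM hE hvE
    refine lintegral_coe_eq_integral _ ?_
    rw [← integrableOn_iff_integrable_of_support_subset (s := E)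
      fun x hx => by_contra fun hE => hx (by simp [hvE x hE])]
    exact Measure.integrableOn_of_bounded (M := M) hE.measure_lt_top.ne
      hv.coe_nnreal_real.aestronglyMeasurable
      (Eventually.of_forall fun x => by simpa using hM x)
  refine ⟨c, fun {v M B} hv hM => ⟨fun hB => ?_, fun E hE hvE hB => ?_⟩⟩
  -- Truncation to a compact set only decreases the sums, so the upper bound passes to functions
  -- without compact support by monotone convergence.
  · let K := CompactExhaustion.choice G
    have hn : ∀ n, c * ∫⁻ x in K n, v x ∂μ ≤ B := by
      intro n
      have hK := K.isCompact n
      let w : G → ℝ≥0 := (K n).indicator v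
      have hw : Measurable w := hv.indicator hK.measurableSet
      have hwv : ∀ x, w x ≤ v x := Set.indicator_le_self (K n) v
      have h0 : ∀ x ∉ K n, w x = 0 := fun x hx => Set.indicator_of_notMem hx v
      have hle := hc (u := fun x => (w x : ℝ)) (M := M) (B := B)
        hw.coe_nnreal_real (fun x => by simpa using (hwv x).trans (hM x)) hK
        (fun x hx => by simp [h0 x hx]) fun x => by
          refine (ENNReal.ofReal_le_ofReal_iff B.2).1 ?_
          rw [h.ofReal_pointSum hK h0]
          refine (ENNReal.tsum_le_tsum fun l => ?_).trans ((hB x).trans_eq (by simp))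
          exact_mod_cast hwv _
      have hwc : (K n).indicator (fun x => (v x : ℝ≥0∞)) = fun x => (w x : ℝ≥0∞) := by
        ext x
        by_cases hx : x ∈ K n <;> simp [w, hx]
      rw [← lintegral_indicator hK.measurableSet, hwc,
        hlint hw (fun x => (hwv x).trans (hM x)) hK h0, ← ENNReal.ofReal_coe_nnreal,
        ← ENNReal.ofReal_mul c.coe_nonneg, ← ENNReal.ofReal_coe_nnreal]
      exact ENNReal.ofReal_le_ofReal hle
    rw [← setLIntegral_univ, ← K.iUnion_eq, setLIntegral_iUnion_of_directed _
      (directed_of_isDirected_le fun _ _ hmn => K.subset hmn), ENNReal.mul_iSup]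
    exact iSup_le hn
  -- The lower bound is the signed upper bound applied to `-v` and `-B`.
  · have hle := hc (u := fun x => -(v x : ℝ)) (M := M) (B := -B)
        hv.coe_nnreal_real.neg (fun x => by simpa using hM x) hE (fun x hx => by simp [hvE x hx])
        fun x => by
          have : pointSum Λ (fun y => -(v y : ℝ)) x = -pointSum Λ (fun y => (v y : ℝ)) x :=
            finsum_neg_distrib _
          rw [this, neg_le_neg_iff, ← ENNReal.ofReal_le_ofReal_iff
            (pointSum_nonneg Λ (fun _ => NNReal.coe_nonneg _) x), h.ofReal_pointSum hE hvE]
          simpa using hB x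
    rw [integral_neg, mul_neg, neg_le_neg_iff] at hle
    rw [hlint hv hM hE hvE, ← ENNReal.ofReal_coe_nnreal, ← ENNReal.ofReal_coe_nnreal,
      ← ENNReal.ofReal_mul c.coe_nonneg]
    exact ENNReal.ofReal_le_ofReal hle

end CoveringConstantENNReal

/-! ### Separation and density bounds for the constant -/

section CoveringConstantBounds

open Filter
open scoped NNReal

variable {G : Type*} [Group G]

theorem IsSeparatedBy.eq_of_mem {Λ S : Set G} (h : IsSeparatedBy Λ S) {g l l' : G} (hl : l ∈ Λ)
    (hl' : l' ∈ Λ) (hg : l ∈ g • S) (hg' : l' ∈ g • S) : l = l' :=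
  Set.encard_le_one_iff.1 (h g) l l' ⟨hl, hg⟩ ⟨hl', hg'⟩

theorem IsSeparatedBy.tsum_indicator_le_one {Λ S : Set G} (h : IsSeparatedBy Λ S) (x : G) :
    ∑' l : Λ, ((S.indicator 1 (x * l) : ℝ≥0) : ℝ≥0∞) ≤ 1 := by
  by_cases hl : ∃ l : Λ, x * l ∈ S
  · obtain ⟨l, hl⟩ := hl
    rw [tsum_eq_single l]
    · simp [hl]
    · intro l' hne
      by_contra h0
      refine hne (Subtype.ext (h.eq_of_mem (g := x⁻¹) l'.2 l.2 ⟨x * l', ?_, by simp⟩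
        ⟨x * l, hl, by simp⟩))
      by_contra hS
      simp [hS] at h0
  · push Not at hl
    simp [hl]

theorem IsDenseBy.one_le_tsum_indicator {Λ S : Set G} (h : IsDenseBy Λ S) (x : G) :
    1 ≤ ∑' l : Λ, ((S.indicator 1 (x * l) : ℝ≥0) : ℝ≥0∞) := by
  obtain ⟨_, hl, s, hs, rfl⟩ := Set.one_le_encard_iff_nonempty.1 (h x⁻¹)
  refine le_trans ?_ (ENNReal.le_tsum ⟨_, hl⟩)
  simp [hs]

variable [TopologicalSpace G] [IsTopologicalGroup G] [T2Space G]
  [LocallyCompactSpace G] [SecondCountableTopology G] [MeasurableSpace G] [BorelSpace G]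

omit [T2Space G] [MeasurableSpace G] [BorelSpace G] in
theorem IsUniformlyLocallyFinite.countable {Λ : Set G} (h : IsUniformlyLocallyFinite Λ) :
    Λ.Countable := by
  let K := CompactExhaustion.choice G
  have : Λ = ⋃ n, Λ ∩ (1 : G) • K n := by
    simp [← Set.inter_iUnion, K.iUnion_eq]
  rw [this]
  refine Set.countable_iUnion fun n => ?_
  obtain ⟨N, hN⟩ := h _ (K.isCompact n)
  exact (Set.finite_of_encard_le_coe (hN 1)).countable

/-- In an amenable group, sums over the translates of a separated set compare to the Haar integral
with a constant that is controlled by the separation and the density of the set. -/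
theorem IsSeparatedBy.exists_mul_lintegral_le (hG : IsAmenableGroup G) (μ : Measure G)
    [μ.IsHaarMeasure] {Λ U : Set G} (h : IsSeparatedBy Λ U) (hU : IsOpen U) (hne : U.Nonempty) :
    ∃ c : ℝ≥0, c * μ U ≤ 1 ∧ (∀ K, IsCompact K → IsDenseBy Λ K → 1 ≤ c * μ K) ∧
      ∀ {v : G → ℝ≥0} {M B : ℝ≥0}, Measurable v → (∀ x, v x ≤ M) →
        ((∀ x, ∑' l : Λ, (v (x * l) : ℝ≥0∞) ≤ B) → c * ∫⁻ x, v x ∂μ ≤ B) ∧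
        ∀ E : Set G, IsCompact E → (∀ x ∉ E, v x = 0) →
          (∀ x, (B : ℝ≥0∞) ≤ ∑' l : Λ, (v (x * l) : ℝ≥0∞)) → B ≤ c * ∫⁻ x, v x ∂μ := by
  obtain ⟨c, hc⟩ := (h.isUniformlyLocallyFinite hU hne).exists_mul_lintegral_le hG μ
  have hint : ∀ S : Set G, MeasurableSet S →
      ∫⁻ x, ((S.indicator 1 x : ℝ≥0) : ℝ≥0∞) ∂μ = μ S := fun S hS => by
    rw [← lintegral_indicator_one hS]
    congr with x
    by_cases hx : x ∈ S <;> simp [hx]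
  have hone : ∀ (S : Set G) (x : G), (S.indicator 1 x : ℝ≥0) ≤ 1 :=
    fun S x => Set.indicator_le_self S 1 x
  refine ⟨c, ?_, fun K hK hd => ?_, hc⟩
  · rw [← hint U hU.measurableSet]
    exact (hc (B := 1) (measurable_one.indicator hU.measurableSet) (hone U)).1
      h.tsum_indicator_le_one
  · rw [← hint K hK.measurableSet]
    exact (hc (B := 1) (measurable_one.indicator hK.measurableSet) (hone K)).2 K hK
      (fun x hx => Set.indicator_of_notMem hx _) hd.one_le_tsum_indicator

end CoveringConstantBounds

/-! ### Uniform control of tails by the local maximal function -/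

section Tails

open Filter
open scoped NNReal

variable {G : Type*} [Group G] [TopologicalSpace G] [IsTopologicalGroup G]
  [MeasurableSpace G] [BorelSpace G]

/-- The samples of `F` far from `E` are dominated by the local maximal function of `F` off `E`. -/
theorem IsSeparatedBy.mul_tsum_indicator_le (μ : Measure G) [μ.IsMulLeftInvariant]
    {Λ V Q E : Set G} (h : IsSeparatedBy Λ V) (hΛ : Λ.Countable) (hV : IsOpen V) (hVQ : V ⊆ Q)
    (F : G → ℂ) (x : G) :
    μ V⁻¹ * ∑' l : Λ, (E * Q)ᶜ.indicator (fun y => ‖F y‖ₑ ^ 2) (x * l) ≤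
      ∫⁻ y in Eᶜ, localMaximal Q F y ^ 2 ∂μ := by
  have : Countable Λ := hΛ
  -- If `y ∈ s l`, then `x * l = y * q` with `q ∈ V ⊆ Q`, so the sample at `x * l` is at most the
  -- local maximal function at `y`, and `x * l ∉ E * Q` forces `y ∉ E`. Separation makes these sets
  -- disjoint, and left invariance gives each nonempty one the measure of `V⁻¹`.
  let s : Λ → Set G := fun l => {y | y ∈ (x * l) • V⁻¹ ∧ x * l ∉ E * Q}
  have hs : ∀ l, MeasurableSet (s l) := fun l =>
    ((hV.inv.smul (x * (l : G))).measurableSet).inter (.const _)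
  have hmem : ∀ {l : Λ} {y : G}, y ∈ s l → ∃ q ∈ V, y * q = x * l := by
    rintro l _ ⟨⟨v, hv, rfl⟩, -⟩
    exact ⟨v⁻¹, hv, by simp⟩
  have hd : Pairwise (Function.onFun Disjoint s) := by
    intro l l' hne
    refine Set.disjoint_left.2 fun y hy hy' => hne (Subtype.ext ?_)
    obtain ⟨q, hq, hyq⟩ := hmem hy
    obtain ⟨q', hq', hyq'⟩ := hmem hy'
    refine h.eq_of_mem (g := x⁻¹ * y) l.2 l'.2 ⟨q, hq, ?_⟩ ⟨q', hq', ?_⟩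
    · simp [mul_assoc, hyq]
    · simp [mul_assoc, hyq']
  calc μ V⁻¹ * ∑' l : Λ, (E * Q)ᶜ.indicator (fun y => ‖F y‖ₑ ^ 2) (x * l)
      = ∑' l : Λ, ∫⁻ _ in s l, ‖F (x * l)‖ₑ ^ 2 ∂μ := by
        rw [← ENNReal.tsum_mul_left]
        congr with l
        rw [setLIntegral_const]
        by_cases hl : x * (l : G) ∈ E * Q
        · simp [s, hl]
        · have hsl : s l = (x * (l : G)) • V⁻¹ := Set.ext fun y => and_iff_left hl
          rw [hsl, measure_smul, Set.indicator_of_mem (by exact hl), mul_comm]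
    _ ≤ ∑' l : Λ, ∫⁻ y in s l, localMaximal Q F y ^ 2 ∂μ := by
        refine ENNReal.tsum_le_tsum fun l => setLIntegral_mono' (hs l) fun y hy => ?_
        obtain ⟨q, hq, hyq⟩ := hmem hy
        rw [← hyq]
        gcongr
        exact le_iSup₂ (f := fun q _ => ‖F (y * q)‖ₑ) q (hVQ hq)
    _ = ∫⁻ y in ⋃ l, s l, localMaximal Q F y ^ 2 ∂μ := (lintegral_iUnion hs hd _).symm
    _ ≤ ∫⁻ y in Eᶜ, localMaximal Q F y ^ 2 ∂μ := by
        refine lintegral_mono_set (Set.iUnion_subset fun l y hy hyE => hy.2 ?_)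
        obtain ⟨q, hq, hyq⟩ := hmem hy
        exact ⟨y, hyE, q, hVQ hq, hyq⟩

-- Continuity from above of the finite measure with density `φ`. Only the sets have to be
-- measurable, so this applies to a local maximal function, a possibly uncountable supremum.
omit [Group G] [IsTopologicalGroup G] in
theorem tendsto_setLIntegral_compl_compactExhaustion [T2Space G] (μ : Measure G)
    (K : CompactExhaustion G) {φ : G → ℝ≥0∞} (hφ : ∫⁻ x, φ x ∂μ ≠ ∞) :
    Tendsto (fun n => ∫⁻ x in (K n)ᶜ, φ x ∂μ) atTop (𝓝 0) := by
  have hm : ∀ n, MeasurableSet (K n)ᶜ := fun n => (K.isCompact n).measurableSet.compl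
  have : IsFiniteMeasure (μ.withDensity φ) := isFiniteMeasure_withDensity hφ
  have ht := tendsto_measure_iInter_atTop (μ := μ.withDensity φ) (s := fun n => (K n)ᶜ)
    (fun n => (hm n).nullMeasurableSet) (fun m n hmn => Set.compl_subset_compl.2 (K.subset hmn))
    ⟨0, measure_ne_top _ _⟩
  rw [← Set.compl_iUnion, K.iUnion_eq, Set.compl_univ, measure_empty] at ht
  exact ht.congr fun n => withDensity_apply _ (hm n)

end Tails

/-! ### Frame bounds and the norm of the wavelet transform -/

section FrameBounds

open Filter
open scoped NNReal

theorem eLpNorm_two_sq {α ε : Type*} [MeasurableSpace α] [ENorm ε] (μ : Measure α) (f : α → ε) :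
    eLpNorm f 2 μ ^ 2 = ∫⁻ x, ‖f x‖ₑ ^ 2 ∂μ := by
  have := eLpNorm_nnreal_pow_eq_lintegral (f := f) (μ := μ) (p := 2) two_ne_zero
  simpa using this

variable {G H : Type*} [Group G] [MeasurableSpace G] [NormedAddCommGroup H]
  [InnerProductSpace ℂ H]

theorem stronglyMeasurable_waveletTransform {π : G → (H ≃ₗᵢ[ℂ] H)} (hπ : IsProjectiveUnitaryRep π)
    (ψ f : H) : StronglyMeasurable (waveletTransform π ψ f) :=
  (hπ.stronglyMeasurable ψ).inner stronglyMeasurable_const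

omit [Group G] [MeasurableSpace G] in
theorem nnnorm_waveletTransform_le (π : G → (H ≃ₗᵢ[ℂ] H)) (ψ f : H) (x : G) :
    ‖waveletTransform π ψ f x‖₊ ≤ ‖ψ‖₊ * ‖f‖₊ :=
  (nnnorm_inner_le_nnnorm _ _).trans_eq (by rw [(π x).nnnorm_map])

/-- Up to the unimodular cocycle, `π (x * l) ψ` is `π x (π l ψ)`, and the unitary `π x` can be moved
to the other side. Sampling along `x Λ` thus amounts to replacing `f` by a vector of the same norm.
-/
theorem enorm_waveletTransform_mul {π : G → (H ≃ₗᵢ[ℂ] H)} (hπ : IsProjectiveUnitaryRep π)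
    (ψ f : H) (x l : G) :
    ‖waveletTransform π ψ f (x * l)‖ₑ = ‖inner ℂ (π l ψ) ((π x).symm f)‖ₑ := by
  obtain ⟨σ, -, hσ⟩ := hπ.map_mul
  have h := (π x).inner_map_map (π l ψ) ((π x).symm f)
  rw [LinearIsometryEquiv.apply_symm_apply, hσ, inner_smul_left] at h
  rw [← h, enorm_mul, waveletTransform]
  simp [← ofReal_norm, Circle.norm_coe]

theorem IsBesselWith.tsum_waveletTransform_le {π : G → (H ≃ₗᵢ[ℂ] H)}
    (hπ : IsProjectiveUnitaryRep π) {ψ : H} {Λ : Set G} {C : ℝ}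
    (h : IsBesselWith (orbitFamily π Λ ψ) C) (f : H) (x : G) :
    ∑' l : Λ, ‖waveletTransform π ψ f (x * l)‖ₑ ^ 2 ≤ ENNReal.ofReal C * ‖f‖ₑ ^ 2 := by
  simp_rw [enorm_waveletTransform_mul hπ]
  simpa [orbitFamily] using h ((π x).symm f)

theorem HasLowerFrameBound.le_tsum_waveletTransform {π : G → (H ≃ₗᵢ[ℂ] H)}
    (hπ : IsProjectiveUnitaryRep π) {ψ : H} {Λ : Set G} {C : ℝ}
    (h : HasLowerFrameBound (orbitFamily π Λ ψ) C) (f : H) (x : G) :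
    ENNReal.ofReal C * ‖f‖ₑ ^ 2 ≤ ∑' l : Λ, ‖waveletTransform π ψ f (x * l)‖ₑ ^ 2 := by
  simp_rw [enorm_waveletTransform_mul hπ]
  simpa [orbitFamily] using h ((π x).symm f)

variable [TopologicalSpace G] [IsTopologicalGroup G] [T2Space G]
  [LocallyCompactSpace G] [SecondCountableTopology G] [BorelSpace G]

theorem IsSeparatedBy.eLpNorm_waveletTransform_sq_le (hG : IsAmenableGroup G) (μ : Measure G)
    [μ.IsHaarMeasure] {π : G → (H ≃ₗᵢ[ℂ] H)} (hπ : IsProjectiveUnitaryRep π) {ψ : H}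
    {Λ U K : Set G} (h : IsSeparatedBy Λ U) (hU : IsOpen U) (hne : U.Nonempty)
    (hd : IsDenseBy Λ K) (hK : IsCompact K) {C : ℝ}
    (hB : IsBesselWith (orbitFamily π Λ ψ) C) (f : H) :
    eLpNorm (waveletTransform π ψ f) 2 μ ^ 2 ≤ ENNReal.ofReal C * μ K * ‖f‖ₑ ^ 2 := by
  obtain ⟨c, -, hc, hv⟩ := h.exists_mul_lintegral_le hG μ hU hne
  have hle := (hv (v := fun x => ‖waveletTransform π ψ f x‖₊ ^ 2) (M := (‖ψ‖₊ * ‖f‖₊) ^ 2)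
    (B := C.toNNReal * ‖f‖₊ ^ 2)
    ((stronglyMeasurable_waveletTransform hπ ψ f).measurable.nnnorm.pow_const 2)
    fun x => pow_le_pow_left₀ (zero_le) (nnnorm_waveletTransform_le π ψ f x) 2).1 fun x => by
      push_cast
      exact hB.tsum_waveletTransform_le hπ f x
  push_cast at hle
  rw [eLpNorm_two_sq]
  calc ∫⁻ x, ‖waveletTransform π ψ f x‖ₑ ^ 2 ∂μ
      ≤ (c * μ K) * ∫⁻ x, ‖waveletTransform π ψ f x‖ₑ ^ 2 ∂μ :=
        le_mul_of_one_le_left' (hc K hK hd)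
    _ = μ K * (c * ∫⁻ x, ‖waveletTransform π ψ f x‖ₑ ^ 2 ∂μ) := by ring
    _ ≤ μ K * (ENNReal.ofReal C * ‖f‖ₑ ^ 2) := by
        gcongr _ * ?_
        exact hle
    _ = ENNReal.ofReal C * μ K * ‖f‖ₑ ^ 2 := by ring

theorem IsSeparatedBy.le_eLpNorm_waveletTransform_sq (hG : IsAmenableGroup G) (μ : Measure G)
    [μ.IsHaarMeasure] {π : G → (H ≃ₗᵢ[ℂ] H)} (hπ : IsProjectiveUnitaryRep π) {ψ : H}
    {Λ U Q : Set G} (h : IsSeparatedBy Λ U) (hU : IsOpen U) (hne : U.Nonempty)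
    (hQc : IsCompact Q) (hQ : Q ∈ 𝓝 (1 : G)) (hψ : ψ ∈ analyzingSpace μ Q π) {C : ℝ}
    (hB : HasLowerFrameBound (orbitFamily π Λ ψ) C) (f : H) :
    ENNReal.ofReal C * μ U * ‖f‖ₑ ^ 2 ≤ eLpNorm (waveletTransform π ψ f) 2 μ ^ 2 := by
  obtain ⟨c, hcU, -, hv⟩ := h.exists_mul_lintegral_le hG μ hU hne
  have hΛ := (h.isUniformlyLocallyFinite hU hne).countable
  obtain ⟨u, hu⟩ := hne
  -- Tail control needs a neighbourhood of `1` inside `Q` for which `Λ` is separated. Translating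
  -- `U` to contain `1` and shrinking it preserves separation.
  set V : Set G := interior Q ∩ u⁻¹ • U
  have hVo : IsOpen V := isOpen_interior.inter (hU.smul _)
  have hV1 : (1 : G) ∈ V := ⟨mem_interior_iff_mem_nhds.2 hQ, u, hu, by simp⟩
  have hVQ : V ⊆ Q := Set.inter_subset_left.trans interior_subset
  have hVs : IsSeparatedBy Λ V := fun g => by
    refine (Set.encard_le_encard ?_).trans (h (g * u⁻¹))
    rw [mul_smul]
    exact Set.inter_subset_inter_right _ (Set.smul_set_mono Set.inter_subset_right)
  have hV0 : μ V⁻¹ ≠ 0 := (hVo.inv.measure_pos μ ⟨1, by simpa using hV1⟩).ne'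
  have hVt : μ V⁻¹ ≠ ∞ :=
    ((measure_mono (Set.inv_subset_inv.2 hVQ)).trans_lt hQc.inv.measure_lt_top).ne
  set F := waveletTransform π ψ f
  set K := CompactExhaustion.choice G
  have hφ : ∫⁻ x, localMaximal Q F x ^ 2 ∂μ ≠ ∞ := by
    have := eLpNorm_two_sq μ (localMaximal Q F)
    simp only [enorm_eq_self] at this
    rw [← this]
    exact (ENNReal.pow_lt_top (hψ f).2).ne
  have hlim : Tendsto (fun n => c * ∫⁻ x, ‖F x‖ₑ ^ 2 ∂μ +
      (μ V⁻¹)⁻¹ * ∫⁻ x in (K n)ᶜ, localMaximal Q F x ^ 2 ∂μ) atTop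
      (𝓝 (c * ∫⁻ x, ‖F x‖ₑ ^ 2 ∂μ)) := by
    have := (ENNReal.Tendsto.const_mul (tendsto_setLIntegral_compl_compactExhaustion μ K hφ)
      (.inr (ENNReal.inv_ne_top.2 hV0))).const_add (c * ∫⁻ x, ‖F x‖ₑ ^ 2 ∂μ)
    simpa using this
  have hle : ENNReal.ofReal C * ‖f‖ₑ ^ 2 ≤ c * ∫⁻ x, ‖F x‖ₑ ^ 2 ∂μ := by
    -- Cut `|F|²` off outside `K n * Q`. The discarded samples sum to at most `ε` for every `x`, so
    -- the truncated sums are at least `C ‖f‖² - ε`, and the lower comparison for compact support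
    -- applies.
    refine ge_of_tendsto' hlim fun n => ?_
    set ε := (μ V⁻¹)⁻¹ * ∫⁻ x in (K n)ᶜ, localMaximal Q F x ^ 2 ∂μ
    have hKQ : IsCompact (K n * Q) := (K.isCompact n).mul hQc
    set v : G → ℝ≥0 := (K n * Q).indicator fun x => ‖F x‖₊ ^ 2
    have hBt : ENNReal.ofReal C * ‖f‖ₑ ^ 2 - ε ≠ ∞ :=
      (tsub_le_self.trans_lt (ENNReal.mul_lt_top ENNReal.ofReal_lt_top
        (ENNReal.pow_lt_top enorm_lt_top))).ne
    have hvF : ∀ x, v x ≤ ‖F x‖₊ ^ 2 := Set.indicator_le_self _ _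
    have hlow := (hv (v := v) (M := (‖ψ‖₊ * ‖f‖₊) ^ 2)
      (B := (ENNReal.ofReal C * ‖f‖ₑ ^ 2 - ε).toNNReal)
      (((stronglyMeasurable_waveletTransform hπ ψ f).measurable.nnnorm.pow_const 2).indicator
        hKQ.measurableSet)
      fun x => (hvF x).trans
        (pow_le_pow_left₀ (zero_le) (nnnorm_waveletTransform_le π ψ f x) 2)).2 (K n * Q) hKQ
      (fun x hx => Set.indicator_of_notMem hx _) fun x => by
        rw [ENNReal.coe_toNNReal hBt, tsub_le_iff_right]
        have htail : ∑' l : Λ, (K n * Q)ᶜ.indicator (fun y => ‖F y‖ₑ ^ 2) (x * l) ≤ ε := by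
          rw [← ENNReal.mul_le_iff_le_inv hV0 hVt]
          exact hVs.mul_tsum_indicator_le μ hΛ hVo hVQ F x
        refine (hB.le_tsum_waveletTransform hπ f x).trans ((Eq.le ?_).trans
          (add_le_add_right htail _))
        rw [← ENNReal.tsum_add]
        congr with l
        by_cases hl : x * (l : G) ∈ K n * Q <;> simp [v, hl, F, enorm_eq_nnnorm]
    rw [ENNReal.coe_toNNReal hBt, tsub_le_iff_right] at hlow
    refine hlow.trans ?_
    gcongr with x
    rw [enorm_eq_nnnorm]
    exact_mod_cast hvF x
  rw [eLpNorm_two_sq]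
  calc ENNReal.ofReal C * μ U * ‖f‖ₑ ^ 2 = μ U * (ENNReal.ofReal C * ‖f‖ₑ ^ 2) := by ring
    _ ≤ μ U * (c * ∫⁻ x, ‖F x‖ₑ ^ 2 ∂μ) := by gcongr
    _ = (c * μ U) * ∫⁻ x, ‖F x‖ₑ ^ 2 ∂μ := by ring
    _ ≤ ∫⁻ x, ‖F x‖ₑ ^ 2 ∂μ := mul_le_of_le_one_left' hcU

end FrameBounds

/-! ### Quasi-lattices: separation, density, countability -/

section QuasiLattices

variable {G H : Type*} [Group G] {Λ C S T : Set G}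

theorem IsSeparatedBy.mono (h : IsSeparatedBy Λ S) (hTS : T ⊆ S) : IsSeparatedBy Λ T := fun g =>
  (Set.encard_le_encard (by gcongr)).trans (h g)

theorem IsDenseBy.mono (h : IsDenseBy Λ S) (hST : S ⊆ T) : IsDenseBy Λ T := fun g =>
  (h g).trans (Set.encard_le_encard (by gcongr))

theorem mem_smul_inv_iff_mem_smul {g l : G} : l ∈ g • C⁻¹ ↔ g ∈ l • C := by
  rw [Set.mem_smul_set_iff_inv_smul_mem, Set.mem_smul_set_iff_inv_smul_mem, Set.mem_inv]
  simp

theorem IsQuasiLattice.isSeparatedBy_inv (h : IsQuasiLattice Λ C) : IsSeparatedBy Λ C⁻¹ := by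
  refine fun g => Set.encard_le_one_iff.2 fun l l' hl hl' => ?_
  by_contra hne
  exact Set.disjoint_left.1 (h.2 hl.1 hl'.1 hne) (mem_smul_inv_iff_mem_smul.1 hl.2)
    (mem_smul_inv_iff_mem_smul.1 hl'.2)

theorem IsQuasiLattice.isDenseBy_inv (h : IsQuasiLattice Λ C) : IsDenseBy Λ C⁻¹ := by
  intro g
  obtain ⟨l, hl, hg⟩ := Set.mem_iUnion₂.1 (h.1.symm ▸ Set.mem_univ g)
  exact Set.one_le_encard_iff_nonempty.2 ⟨l, hl, mem_smul_inv_iff_mem_smul.2 hg⟩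

theorem IsQuasiLattice.measure_ne_zero [MeasurableSpace G] [MeasurableMul G] (μ : Measure G)
    [μ.IsMulLeftInvariant] [NeZero μ] (h : IsQuasiLattice Λ C) (hΛ : Λ.Countable) : μ C ≠ 0 := by
  intro h0
  refine NeZero.ne μ (Measure.measure_univ_eq_zero.1 ?_)
  rw [← h.1, measure_biUnion_null_iff hΛ]
  intro l _
  rw [measure_smul, h0]

/-- Strong measurability makes the orbit of `ψ` separable. Each member of a countable set whose
closure contains the orbit is non-orthogonal to only countably many `π l ψ`, by summability, while
each `π l ψ ≠ 0` is non-orthogonal to some member. Tiling alone does not suffice: in a nondiscrete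
group, `C = {1}` and `Λ = G` tile with a Jordan measurable null set. -/
theorem IsBesselWith.countable [MeasurableSpace G] [NormedAddCommGroup H] [InnerProductSpace ℂ H]
    {π : G → (H ≃ₗᵢ[ℂ] H)} (hπ : IsProjectiveUnitaryRep π) {ψ : H} (hψ : ψ ≠ 0) {B : ℝ}
    (h : IsBesselWith (orbitFamily π Λ ψ) B) : Λ.Countable := by
  obtain ⟨c, hc, hcl⟩ := (hπ.stronglyMeasurable ψ).isSeparable_range
  have hcount : (⋃ d ∈ c, {l : Λ | inner ℂ (π l ψ) d ≠ 0}).Countable := by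
    refine hc.biUnion fun d _ => ?_
    have hne : ∑' l, ‖inner ℂ (orbitFamily π Λ ψ l) d‖ₑ ^ 2 ≠ ∞ :=
      ((h d).trans_lt (ENNReal.mul_lt_top ENNReal.ofReal_lt_top
        (ENNReal.pow_lt_top enorm_lt_top))).ne
    refine (Summable.countable_support_ennreal hne).mono fun l hl => ?_
    simpa [orbitFamily] using hl
  refine Set.countable_coe_iff.1 (Set.countable_univ_iff.1 (hcount.mono fun l _ => ?_))
  by_contra hl
  have hd : ∀ d ∈ c, inner ℂ (π l ψ) d = 0 := by simpa using hl
  have hmem := hcl (Set.mem_range_self (l : G))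
  have h0 : inner ℂ (π l ψ) (π l ψ) = 0 :=
    closure_minimal (t := {d | inner ℂ (π l ψ) d = 0}) hd
      (isClosed_eq (by fun_prop) continuous_const) hmem
  exact hψ (by simpa using h0)

omit [Group G] in
theorem HasLowerFrameBound.ne_zero [NormedAddCommGroup H] [InnerProductSpace ℂ H]
    {π : G → (H ≃ₗᵢ[ℂ] H)} {ψ f : H} {A : ℝ} (hA : 0 < A)
    (h : HasLowerFrameBound (orbitFamily π Λ ψ) A) (hf : f ≠ 0) : ψ ≠ 0 := by
  rintro rfl
  simpa [orbitFamily, hA.not_ge, hf] using h f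

end QuasiLattices

/-! ### The main theorem -/

theorem mainTheorem4
    {G : Type*} [Group G] [TopologicalSpace G] [IsTopologicalGroup G] [T2Space G]
    [LocallyCompactSpace G] [SecondCountableTopology G] [MeasurableSpace G] [BorelSpace G]
    (hG : IsAmenableGroup G)
    (μ : Measure G) [μ.IsHaarMeasure]
    {H : Type*} [NormedAddCommGroup H] [InnerProductSpace ℂ H] [CompleteSpace H]
    (π : G → (H ≃ₗᵢ[ℂ] H)) (hπ : IsProjectiveUnitaryRep π)
    (Q : Set G) (hQc : IsCompact Q) (hQ : Q ∈ 𝓝 (1 : G))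
    (ψ : H) :
    (∀ U K Λ : Set G, IsOpen U → U.Nonempty → IsCompact K →
      IsSeparatedBy Λ U → IsDenseBy Λ K →
      ∀ C₂ : ℝ, 0 < C₂ → IsBesselWith (orbitFamily π Λ ψ) C₂ →
        (∀ f : H, eLpNorm (waveletTransform π ψ f) 2 μ ^ 2 ≤
          ENNReal.ofReal C₂ * μ K * ‖f‖ₑ ^ 2) ∧
        (ψ ∈ analyzingSpace μ Q π →
          ∀ C₁ : ℝ, 0 < C₁ → HasLowerFrameBound (orbitFamily π Λ ψ) C₁ →
            ∀ f : H, ENNReal.ofReal C₁ * μ U * ‖f‖ₑ ^ 2 ≤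
              eLpNorm (waveletTransform π ψ f) 2 μ ^ 2)) ∧
    (∀ Λ C : Set G, IsQuasiLattice Λ C → IsCompact (closure C) → IsJordanMeasurable μ C →
      ψ ∈ analyzingSpace μ Q π →
      ∀ C₁ C₂ : ℝ, 0 < C₁ → 0 < C₂ →
        HasLowerFrameBound (orbitFamily π Λ ψ) C₁ → IsBesselWith (orbitFamily π Λ ψ) C₂ →
        ∀ f : H,
          ENNReal.ofReal C₁ * ‖f‖ₑ ^ 2 ≤
              eLpNorm (waveletTransform π ψ f) 2 μ ^ 2 / μ.inv C ∧
            eLpNorm (waveletTransform π ψ f) 2 μ ^ 2 / μ.inv C ≤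
              ENNReal.ofReal C₂ * ‖f‖ₑ ^ 2) := by
  refine ⟨fun U K Λ hU hne hK hs hd C₂ _ hB =>
    ⟨hs.eLpNorm_waveletTransform_sq_le hG μ hπ hU hne hd hK hB, fun hψ C₁ _ hA =>
      hs.le_eLpNorm_waveletTransform_sq hG μ hπ hU hne hQc hQ hψ hA⟩, ?_⟩
  intro Λ C hq hCc hC hψ C₁ C₂ hC₁ _ hA hB f
  -- This case covers `H = {0}`, where `μ.inv C` may vanish and the quotient `0 / 0` is `0`. A
  -- nonzero `f` forces `ψ ≠ 0` through the lower frame bound.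
  rcases eq_or_ne f 0 with rfl | hf
  · simp [eLpNorm_two_sq, waveletTransform]
  have hΛ := hB.countable hπ (hA.ne_zero hC₁ hf)
  -- Left and right Haar measure have the same null sets, so the boundary of `C` is null for both.
  have hfr : μ.inv (frontier C) = 0 := inv_absolutelyContinuous μ hC
  have hcl : μ (closure C)⁻¹ = μ.inv C := by
    rw [← Measure.inv_apply, measure_closure_of_null_frontier hfr]
  have hint : μ (interior C)⁻¹ = μ.inv C := by
    rw [← Measure.inv_apply, measure_interior_of_null_frontier hfr]
  -- Countably many translates of `C` cover `G`, so `C` is not null. As its boundary is null, its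
  -- interior is nonempty and supplies the open set required for separation.
  have h0 : μ.inv C ≠ 0 := fun h =>
    hq.measure_ne_zero μ hΛ (absolutelyContinuous_inv μ h)
  have ht : μ.inv C ≠ ∞ := hcl ▸ hCc.inv.measure_lt_top.ne
  have hne : (interior C)⁻¹.Nonempty := nonempty_of_measure_ne_zero (hint ▸ h0)
  have hs : IsSeparatedBy Λ (interior C)⁻¹ :=
    hq.isSeparatedBy_inv.mono (Set.inv_subset_inv.2 interior_subset)
  have hd : IsDenseBy Λ (closure C)⁻¹ :=
    hq.isDenseBy_inv.mono (Set.inv_subset_inv.2 subset_closure)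
  have hU : IsOpen (interior C)⁻¹ := isOpen_interior.inv
  constructor
  · rw [ENNReal.le_div_iff_mul_le (.inl h0) (.inl ht), mul_right_comm, ← hint]
    exact hs.le_eLpNorm_waveletTransform_sq hG μ hπ hU hne hQc hQ hψ hA f
  · rw [ENNReal.div_le_iff h0 ht, mul_right_comm, ← hcl]
    exact hs.eLpNorm_waveletTransform_sq_le hG μ hπ hU hne hd hCc.inv hB f
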